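/- Let $\mathfrak{s}$ be a finite-dimensional semisimple real Lie algebra, let $\mathfrak{r}$ be an arbitrary real Lie algebra, and let $\mathfrak{g}=\mathfrak{s}\oplus\mathfrak{r}$ be their direct sum as Lie algebras (so $[\mathfrak{s},\mathfrak{r}]=0$). Then there is an isomorphism of real vector spaces $$H^{2}(\mathfrak{g},\mathfrak{g})\;\simeq\;H^{2}(\mathfrak{r},\mathfrak{r}).$$ Here, for a real Lie algebra $L$, $H^2(L,L)=Z^2(L,L)/B^2(L,L)$ denotes the second cohomology space with coefficients in the adjoint module: $Z^2(L,L)$ is the space of alternating bilinear maps $\varphi:L\times L\to L$ such that $$[x,\varphi(y,z)]-[y,\varphi(x,z)]+[z,\varphi(x,y)]-\varphi([x,y],z)+\varphi([x,z],y)-\varphi([y,z],x)=0\qquad(x,y,z\in L),$$ and $B^2(L,L)$ is the subspace of the maps $(x,y)\mapsto[x,f(y)]-[y,f(x)]-f([x,y])$ with $f:L\to L$ linear. -/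

import Mathlib

set_option maxSynthPendingDepth 3

namespace LieAdjointCohomology

open LieModule.Cohomology

section

variable (R : Type*) [CommRing R]
variable (L : Type*) [LieRing L] [LieAlgebra R L]
variable (M : Type*) [AddCommGroup M] [Module R M] [LieRingModule L M] [LieModule R L M]

/-- The 2-coboundaries `B²(L, M)`: the 2-cochains of the form
`(x, y) ↦ ⁅x, f y⁆ - ⁅y, f x⁆ - f ⁅x, y⁆` for a linear map `f : L → M`. -/
def twoCoboundary : Submodule R (twoCochain R L M) :=
  LinearMap.range (d₁₂ R L M)

/-- Every 2-coboundary is a 2-cocycle: `B²(L, M) ⊆ Z²(L, M)`. -/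
theorem twoCoboundary_le_twoCocycle : twoCoboundary R L M ≤ twoCocycle R L M := by
  rintro _ ⟨f, rfl⟩
  rw [mem_twoCocycle_iff]
  exact LinearMap.congr_fun (d₂₃_comp_d₁₂ R L M) f

/-- The second cohomology space `H²(L, M) = Z²(L, M) / B²(L, M)` of the Lie algebra `L` with
coefficients in the `L`-module `M`. For `M = L` the coefficients are the adjoint module. -/
abbrev H2 : Type _ :=
  twoCocycle R L M ⧸ (twoCoboundary R L M).submoduleOf (twoCocycle R L M)

end

end LieAdjointCohomology

/-!
Let `∑ bᵢ ⊗ cᵢ` be the invariant tensor on `s` given by a basis and its dual with respect to the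
Killing form; its Casimir element acts on `s` as the identity and on `r` as zero.

Since `∑ bᵢ • a(cᵢ, ·)` is a homotopy between the Casimir action and zero, the `s`-component of a
2-cocycle `a` of `s × r` is a coboundary. The `r`-component restricts to a 2-cocycle of `s` with
trivial coefficients, which is again a coboundary, by a Casimir argument in the coadjoint
representation. Once both are subtracted, `a` takes values in `r` and vanishes on `s × s`; the
cocycle identity makes it vanish on `⁅s, s⁆ × r`, which is `s × r` as `s` is perfect. Hence every
2-cocycle is cohomologous to one inflated from `r`.
-/

namespace LieAdjointCohomology

open LieModule.Cohomology
open scoped TensorProduct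

section InvariantPair

variable {R L M ι : Type*} [CommRing R] [LieRing L] [LieAlgebra R L] [Fintype ι]
variable [AddCommGroup M] [Module R M]

variable (R) in
/-- Two families `b`, `c` in a Lie algebra form an invariant pair if the tensor `∑ bᵢ ⊗ cᵢ`, whose
image in the universal enveloping algebra is the Casimir element of the pair, is invariant. -/
def IsInvariantPair (b c : ι → L) : Prop :=
  ∀ x : L, ⁅x, ∑ i, b i ⊗ₜ[R] c i⁆ = 0

variable {b c : ι → L}

theorem IsInvariantPair.sum_lie_add_lie (h : IsInvariantPair R b c) (B : L →ₗ[R] L →ₗ[R] M)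
    (y : L) : ∑ i, (B ⁅b i, y⁆ (c i) + B (b i) ⁅c i, y⁆) = 0 := by
  have lift_lie (i : ι) : B ⁅b i, y⁆ (c i) + B (b i) ⁅c i, y⁆ =
      -TensorProduct.lift B ⁅y, b i ⊗ₜ[R] c i⁆ := by
    rw [TensorProduct.LieModule.lie_tmul_right, map_add, TensorProduct.lift.tmul,
      TensorProduct.lift.tmul, ← lie_skew (b i), ← lie_skew (c i), map_neg, map_neg,
      LinearMap.neg_apply, neg_add]
  simp only [lift_lie, Finset.sum_neg_distrib, ← map_sum, ← lie_sum, h y, map_zero, neg_zero]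

theorem IsInvariantPair.inl {L' : Type*} [LieRing L'] [LieAlgebra R L']
    (h : IsInvariantPair R b c) :
    IsInvariantPair R (fun i ↦ ((b i, 0) : L × L')) (fun i ↦ (c i, 0)) := by
  intro x
  have hx := congr(TensorProduct.map (LinearMap.inl R L L') (LinearMap.inl R L L') $(h x.1))
  simpa [lie_sum] using hx

variable [LieRingModule L M] [LieModule R L M]

variable (R M) in
/-- The action on a Lie module of the Casimir element `∑ bᵢ cᵢ` of two families `b`, `c`. -/
def casimir (b c : ι → L) : Module.End R M :=
  ∑ i, LieModule.toEnd R L M (b i) ∘ₗ LieModule.toEnd R L M (c i)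

theorem casimir_apply (b c : ι → L) (m : M) : casimir R M b c m = ∑ i, ⁅b i, ⁅c i, m⁆⁆ := by
  simp [casimir]

theorem linearMap_eq_zero_of_apply_lie_eq_zero {N : Type*} [AddCommGroup N] [Module R N]
    (hbc : casimir R L b c = 1) {f : L →ₗ[R] N} (hf : ∀ x y : L, f ⁅x, y⁆ = 0) : f = 0 := by
  ext x
  have hx : x = ∑ i, ⁅b i, ⁅c i, x⁆⁆ := by
    rw [← casimir_apply (R := R) (M := L), hbc, Module.End.one_apply]
  rw [hx]
  simp [hf]

end InvariantPair

section KillingForm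

variable {K : Type*} [Field K]

section DualBasis

variable {V ι : Type*} [AddCommGroup V] [Module K V] [DecidableEq ι]
  {Φ : LinearMap.BilinForm K V}

theorem repr_eq_apply_dualBasis [Finite ι] (hΦ : Φ.Nondegenerate) (hsymm : Φ.IsSymm)
    (b : Module.Basis ι K V) (x : V) (i : ι) : b.repr x i = Φ x (Φ.dualBasis hΦ b i) := by
  rw [← LinearMap.BilinForm.dualBasis_repr_apply hΦ,
    LinearMap.BilinForm.dualBasis_dualBasis hΦ hsymm]

theorem trace_eq_sum_dualBasis [Fintype ι] (hΦ : Φ.Nondegenerate) (hsymm : Φ.IsSymm)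
    (b : Module.Basis ι K V) (f : V →ₗ[K] V) :
    LinearMap.trace K V f = ∑ i, Φ (f (b i)) (Φ.dualBasis hΦ b i) := by
  simp [LinearMap.trace_eq_matrix_trace K b, Matrix.trace, LinearMap.toMatrix_apply,
    repr_eq_apply_dualBasis hΦ hsymm]

end DualBasis

variable {L ι : Type*} [LieRing L] [LieAlgebra K L] [Fintype ι] [DecidableEq ι]

theorem isInvariantPair_dualBasis {Φ : LinearMap.BilinForm K L} (hΦ : Φ.Nondegenerate)
    (hsymm : Φ.IsSymm) (hinv : Φ.lieInvariant L) (b : Module.Basis ι K L) :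
    IsInvariantPair K b (Φ.dualBasis hΦ b) := by
  intro x
  set c := Φ.dualBasis hΦ b with hc
  have left (i : ι) : ⁅x, b i⁆ ⊗ₜ[K] c i = ∑ j, Φ ⁅x, b i⁆ (c j) • (b j ⊗ₜ[K] c i) := by
    conv_lhs => rw [← b.sum_repr ⁅x, b i⁆]
    simp only [TensorProduct.sum_tmul, TensorProduct.smul_tmul', hc,
      repr_eq_apply_dualBasis hΦ hsymm]
  have right (i : ι) : b i ⊗ₜ[K] ⁅x, c i⁆ = ∑ j, Φ ⁅x, c i⁆ (b j) • (b i ⊗ₜ[K] c j) := by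
    conv_lhs => rw [← c.sum_repr ⁅x, c i⁆]
    simp only [TensorProduct.tmul_sum, TensorProduct.tmul_smul, hc,
      LinearMap.BilinForm.dualBasis_repr_apply]
  have skew (i j : ι) : Φ ⁅x, b i⁆ (c j) = -Φ ⁅x, c j⁆ (b i) := by
    rw [hinv, hsymm.eq]
  calc ⁅x, ∑ i, b i ⊗ₜ[K] c i⁆
      = ∑ i, ⁅x, b i⁆ ⊗ₜ[K] c i + ∑ i, b i ⊗ₜ[K] ⁅x, c i⁆ := by
        simp only [lie_sum, TensorProduct.LieModule.lie_tmul_right, Finset.sum_add_distrib]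
    _ = -∑ i, ∑ j, Φ ⁅x, c j⁆ (b i) • (b j ⊗ₜ[K] c i) +
          ∑ i, ∑ j, Φ ⁅x, c i⁆ (b j) • (b i ⊗ₜ[K] c j) := by
        simp only [left, right, skew, neg_smul, Finset.sum_neg_distrib]
    _ = 0 := by rw [Finset.sum_comm, neg_add_cancel]

variable [LieAlgebra.IsKilling K L]

theorem casimir_dualBasis_killingForm (b : Module.Basis ι K L) :
    casimir K L b
      ((killingForm K L).dualBasis (LieAlgebra.IsKilling.killingForm_nondegenerate K L) b) = 1 := by
  have := b.finiteDimensional_of_finite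
  set c := (killingForm K L).dualBasis (LieAlgebra.IsKilling.killingForm_nondegenerate K L) b
  have hinj : Function.Injective (killingForm K L) :=
    LinearMap.ker_eq_bot.mp (LieAlgebra.IsKilling.ker_killingForm_eq_bot K L)
  have rotate (x y : L) (i : ι) :
      killingForm K L ⁅b i, ⁅c i, x⁆⁆ y = killingForm K L ⁅x, ⁅y, b i⁆⁆ (c i) := by
    rw [LieModule.traceForm_apply_lie_apply, LieModule.traceForm_comm,
      LieModule.traceForm_apply_lie_apply, LieModule.traceForm_apply_lie_apply,
      LieModule.traceForm_comm]
  ext x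
  refine hinj (LinearMap.ext fun y ↦ ?_)
  calc killingForm K L (casimir K L b c x) y
      = ∑ i, killingForm K L ⁅x, ⁅y, b i⁆⁆ (c i) := by
        simp only [casimir_apply, map_sum, LinearMap.sum_apply, rotate]
    _ = killingForm K L x y := by
        rw [killingForm_apply_apply, trace_eq_sum_dualBasis
          (LieAlgebra.IsKilling.killingForm_nondegenerate K L) ⟨LieModule.traceForm_comm K L L⟩ b]
        rfl

end KillingForm

section Functoriality

variable {R L L' M M' : Type*} [CommRing R] [LieRing L] [LieAlgebra R L] [LieRing L']
  [LieAlgebra R L'] [AddCommGroup M] [Module R M] [AddCommGroup M'] [Module R M']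

/-- The map on 2-cochains given by pulling back along `p` and pushing forward along `q`; it is how
inflation and restriction are expressed. -/
def twoCochainMap (p : L' →ₗ⁅R⁆ L) (q : M →ₗ[R] M') :
    twoCochain R L M →ₗ[R] twoCochain R L' M' where
  toFun a := ⟨(a.1.compl₁₂ (p : L' →ₗ[R] L) (p : L' →ₗ[R] L)).compr₂ q, fun x ↦ by simp⟩
  map_add' a b := by ext; simp
  map_smul' t a := by ext; simp

@[simp]
theorem twoCochainMap_apply_apply (p : L' →ₗ⁅R⁆ L) (q : M →ₗ[R] M') (a : twoCochain R L M)
    (x y : L') : twoCochainMap p q a x y = q (a (p x) (p y)) :=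
  rfl

variable [LieRingModule L M] [LieModule R L M] [LieRingModule L' M'] [LieModule R L' M']
  (p : L' →ₗ⁅R⁆ L) (q : M →ₗ[R] M') (hpq : ∀ x m, q ⁅p x, m⁆ = ⁅x, q m⁆)

include hpq in
theorem twoCochainMap_mem_twoCocycle {a : twoCochain R L M} (ha : a ∈ twoCocycle R L M) :
    twoCochainMap p q a ∈ twoCocycle R L' M' := by
  rw [mem_twoCocycle_iff] at ha ⊢
  ext x y z
  have := congr(q ($ha (p x) (p y) (p z)))
  simpa [hpq] using this

include hpq in
theorem twoCochainMap_mem_twoCoboundary {a : twoCochain R L M} (ha : a ∈ twoCoboundary R L M) :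
    twoCochainMap p q a ∈ twoCoboundary R L' M' := by
  obtain ⟨f, rfl⟩ := ha
  refine ⟨q ∘ₗ f ∘ₗ (p : L' →ₗ[R] L), ?_⟩
  ext x y
  simp [hpq]

/-- The map on second cohomology induced by a compatible pair of a Lie algebra homomorphism and
a linear map of coefficients. -/
def H2Map : H2 R L M →ₗ[R] H2 R L' M' :=
  Submodule.mapQ _ _
    ((twoCochainMap p q).restrict fun _ ha ↦ twoCochainMap_mem_twoCocycle p q hpq ha)
    fun _ ha ↦ twoCochainMap_mem_twoCoboundary p q hpq ha

end Functoriality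

section Whitehead

variable {R L M ι : Type*} [CommRing R] [LieRing L] [LieAlgebra R L] [Fintype ι]
variable [AddCommGroup M] [Module R M] [LieRingModule L M] [LieModule R L M]
variable {b c : ι → L} {a : twoCochain R L M}

theorem lie_apply_of_mem_twoCocycle (ha : a ∈ twoCocycle R L M) (x y z : L) :
    ⁅x, a y z⁆ = ⁅y, a x z⁆ - ⁅z, a x y⁆ + a ⁅x, y⁆ z - a ⁅x, z⁆ y - a x ⁅y, z⁆ := by
  rw [mem_twoCocycle_iff] at ha
  have hxyz : d₂₃ R L M a x y z = 0 := congr($ha x y z)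
  rw [d₂₃_apply] at hxyz
  rw [← twoCochain_skew a ⁅y, z⁆ x, ← sub_eq_zero, ← hxyz]
  abel

/-- The contraction `x ↦ ∑ bᵢ • a(cᵢ, x)` of a 2-cochain with a pair of families; for an invariant
pair it is a homotopy between the action of the Casimir element and zero. -/
def casimirContraction (b c : ι → L) (a : twoCochain R L M) : oneCochain R L M :=
  ∑ i, LieModule.toEnd R L M (b i) ∘ₗ a (c i)

theorem casimir_apply_eq_d₁₂ (h : IsInvariantPair R b c) (ha : a ∈ twoCocycle R L M) (y z : L) :
    casimir R M b c (a y z) = d₁₂ R L M (casimirContraction b c a) y z := by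
  have contract (x : L) : casimirContraction b c a x = ∑ i, ⁅b i, a (c i) x⁆ := by
    simp [casimirContraction]
  have invariance (y z : L) : ∑ i, (⁅⁅b i, y⁆, a (c i) z⁆ + ⁅b i, a ⁅c i, y⁆ z⁆) = 0 :=
    h.sum_lie_add_lie ((LieModule.toEnd R L M : L →ₗ[R] M →ₗ[R] M).compl₂ (a.1.flip z)) y
  have expand (i : ι) : ⁅b i, ⁅c i, a y z⁆⁆ =
      ⁅y, ⁅b i, a (c i) z⁆⁆ - ⁅z, ⁅b i, a (c i) y⁆⁆ - ⁅b i, a (c i) ⁅y, z⁆⁆ +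
        (⁅⁅b i, y⁆, a (c i) z⁆ + ⁅b i, a ⁅c i, y⁆ z⁆) -
        (⁅⁅b i, z⁆, a (c i) y⁆ + ⁅b i, a ⁅c i, z⁆ y⁆) := by
    simp only [lie_apply_of_mem_twoCocycle ha (c i) y z, lie_sub, lie_add,
      leibniz_lie (b i) y, leibniz_lie (b i) z]
    abel
  simp only [casimir_apply, expand, Finset.sum_sub_distrib, Finset.sum_add_distrib] at invariance ⊢
  simp only [invariance, d₁₂_apply_apply, contract, lie_sum, add_zero, sub_zero]

/-- The primitive `-∑ a(bᵢ, ⁅cᵢ, ·⁆)` comes from regarding `y ↦ a(y, ·)` as a 1-cocycle with values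
in `Hom(L, M)`, on which the Casimir element acts as the identity because it does so on `L`. -/
theorem twoCocycle_le_twoCoboundary_of_isTrivial [LieModule.IsTrivial L M]
    (h : IsInvariantPair R b c) (hbc : casimir R L b c = 1) :
    twoCocycle R L M ≤ twoCoboundary R L M := by
  intro a ha
  rw [mem_twoCocycle_iff_of_trivial] at ha
  refine ⟨-∑ i, a (b i) ∘ₗ LieAlgebra.ad R L (c i), Subtype.ext (LinearMap.ext₂ fun y z ↦ ?_)⟩
  have invariance : ∑ i, (a ⁅b i, y⁆ ⁅c i, z⁆ + a (b i) ⁅⁅c i, y⁆, z⁆) = 0 :=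
    h.sum_lie_add_lie (a.1.compl₂ ((LieAlgebra.ad R L : L →ₗ[R] L →ₗ[R] L).flip z)) y
  have expand (i : ι) : a (b i) ⁅c i, ⁅y, z⁆⁆ =
      (a ⁅b i, y⁆ ⁅c i, z⁆ + a (b i) ⁅⁅c i, y⁆, z⁆) + a y ⁅b i, ⁅c i, z⁆⁆ := by
    rw [leibniz_lie (c i) y z, map_add, ha (b i) y]
    abel
  have casimir_eq : ∑ i, a y ⁅b i, ⁅c i, z⁆⁆ = a y z := by
    rw [← map_sum, ← casimir_apply (R := R), hbc, Module.End.one_apply]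
  rw [twoCochain_val_apply, d₁₂_apply_apply_ofTrivial]
  calc -(-∑ i, a (b i) ∘ₗ LieAlgebra.ad R L (c i)) ⁅y, z⁆
      = ∑ i, a (b i) ⁅c i, ⁅y, z⁆⁆ := by simp
    _ = a y z := by
        rw [Finset.sum_congr rfl fun i _ ↦ expand i, Finset.sum_add_distrib, invariance, zero_add,
          casimir_eq]

end Whitehead

section Prod

variable {R s r ι : Type*} [CommRing R] [LieRing s] [LieAlgebra R s] [LieRing r] [LieAlgebra R r]
  [Fintype ι] {b c : ι → s} {a : twoCochain R (s × r) (s × r)}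

theorem exists_fst_apply_eq_fst_d₁₂ (h : IsInvariantPair R b c) (hbc : casimir R s b c = 1)
    (ha : a ∈ twoCocycle R (s × r) (s × r)) :
    ∃ f : oneCochain R (s × r) (s × r), ∀ y z,
      (a y z).1 = (d₁₂ R (s × r) (s × r) f y z).1 := by
  refine ⟨casimirContraction (fun i ↦ (b i, 0)) (fun i ↦ (c i, 0)) a, fun y z ↦ ?_⟩
  rw [← casimir_apply_eq_d₁₂ h.inl ha]
  conv_lhs => rw [← Module.End.one_apply (R := R) (a y z).1, ← hbc, casimir_apply]
  simp [casimir_apply, Prod.fst_sum]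

theorem exists_snd_apply_inl_inl_eq (h : IsInvariantPair R b c) (hbc : casimir R s b c = 1)
    (ha : a ∈ twoCocycle R (s × r) (s × r)) :
    ∃ f : s →ₗ[R] r, ∀ y z, (a (y, 0) (z, 0)).2 = -f ⁅y, z⁆ := by
  let q : s × r →ₗ[R] TrivialLieModule R s r :=
    (TrivialLieModule.equiv R s r).symm.toLinearMap ∘ₗ LinearMap.snd R s r
  have hq (x : s) (m : s × r) : q ⁅LieHom.inl R s r x, m⁆ = ⁅x, q m⁆ := by
    simp [q, LieModule.IsTrivial.trivial]
  obtain ⟨f, hf⟩ := twoCocycle_le_twoCoboundary_of_isTrivial h hbc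
    (twoCochainMap_mem_twoCocycle (LieHom.inl R s r) q hq ha)
  refine ⟨(TrivialLieModule.equiv R s r).toLinearMap ∘ₗ f, fun y z ↦ ?_⟩
  have hyz : d₁₂ R s (TrivialLieModule R s r) f y z = q (a (y, 0) (z, 0)) := congr($hf y z)
  rw [d₁₂_apply_apply_ofTrivial] at hyz
  exact congr(TrivialLieModule.equiv R s r $hyz.symm)

theorem apply_inl_eq_zero {M : Type*} [AddCommGroup M] [Module R M] [LieRingModule (s × r) M]
    [LieModule R (s × r) M] {a : twoCochain R (s × r) M} (hbc : casimir R s b c = 1)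
    (ha : a ∈ twoCocycle R (s × r) M)
    (hlie : ∀ (x : s) (y z : s × r), ⁅((x, 0) : s × r), a y z⁆ = 0)
    (inl_inl : ∀ y z : s, a (y, 0) (z, 0) = 0) (y : s) (z : s × r) : a (y, 0) z = 0 := by
  have inl_inr (w : r) : a.1.flip (0, w) ∘ₗ LinearMap.inl R s r = 0 := by
    refine linearMap_eq_zero_of_apply_lie_eq_zero hbc fun x y ↦ ?_
    have hxy := lie_apply_of_mem_twoCocycle ha (x, 0) (y, 0) (0, w)
    simpa [inl_inl, hlie, eq_comm] using hxy
  have hz : z = (z.1, 0) + (0, z.2) := by simp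
  rw [hz, map_add, inl_inl, zero_add]
  exact congr($(inl_inr z.2) y)

variable (R s r) in
/-- The endomorphism of the 2-cochains of `s × r` that restricts a cochain to `r`, projects its
values to `r`, and inflates the result back to `s × r`. -/
def twoCochainSnd : twoCochain R (s × r) (s × r) →ₗ[R] twoCochain R (s × r) (s × r) :=
  twoCochainMap ((LieHom.inr R s r).comp (LieHom.snd R s r))
    (LinearMap.inr R s r ∘ₗ LinearMap.snd R s r)

theorem twoCochainSnd_mem_twoCoboundary (ha : a ∈ twoCoboundary R (s × r) (s × r)) :
    twoCochainSnd R s r a ∈ twoCoboundary R (s × r) (s × r) :=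
  twoCochainMap_mem_twoCoboundary _ _ (fun x m ↦ by simp) ha

theorem twoCochainSnd_eq_self (hfst : ∀ y z, (a y z).1 = 0)
    (hinl : ∀ (y : s) (z : s × r), a (y, 0) z = 0) : twoCochainSnd R s r a = a := by
  have apply_eq (y z : s × r) : a y z = a (0, y.2) z := by
    have hy : y = (y.1, 0) + (0, y.2) := by simp
    conv_lhs => rw [hy, map_add, LinearMap.add_apply, hinl, zero_add]
  refine Subtype.ext (LinearMap.ext₂ fun y z ↦ ?_)
  have hyz : a y z = a (0, y.2) (0, z.2) := by
    rw [apply_eq, ← twoCochain_skew, apply_eq, twoCochain_skew]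
  exact Prod.ext (hfst y z).symm congr(Prod.snd $hyz.symm)

theorem exists_sub_d₁₂_fst_and_inl_eq_zero (h : IsInvariantPair R b c)
    (hbc : casimir R s b c = 1) (ha : a ∈ twoCocycle R (s × r) (s × r)) :
    ∃ f : oneCochain R (s × r) (s × r),
      (∀ y z, ((a - d₁₂ R (s × r) (s × r) f) y z).1 = 0) ∧
        ∀ (y : s) (z : s × r), (a - d₁₂ R (s × r) (s × r) f) (y, 0) z = 0 := by
  obtain ⟨f, hf⟩ := exists_fst_apply_eq_fst_d₁₂ h hbc ha
  obtain ⟨g, hg⟩ := exists_snd_apply_inl_inl_eq h hbc ha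
  let F : oneCochain R (s × r) (s × r) :=
    (LinearMap.fst R s r ∘ₗ f).prod (g ∘ₗ LinearMap.fst R s r)
  have hF : a - d₁₂ R (s × r) (s × r) F ∈ twoCocycle R (s × r) (s × r) :=
    sub_mem ha (twoCoboundary_le_twoCocycle R _ _ ⟨F, rfl⟩)
  have hfst (y z : s × r) : ((a - d₁₂ R (s × r) (s × r) F) y z).1 = 0 := by
    change (a y z).1 - (d₁₂ R (s × r) (s × r) F y z).1 = 0
    rw [hf, sub_eq_zero]
    simp [F]
  have hsnd (y z : s) : ((a - d₁₂ R (s × r) (s × r) F) (y, 0) (z, 0)).2 = 0 := by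
    change (a (y, 0) (z, 0)).2 - (d₁₂ R (s × r) (s × r) F (y, 0) (z, 0)).2 = 0
    rw [hg, sub_eq_zero]
    simp [F]
  refine ⟨F, hfst, apply_inl_eq_zero hbc hF (fun x y z ↦ ?_) fun y z ↦
    Prod.ext (hfst _ _) (hsnd y z)⟩
  simp only [LieAlgebra.Prod.bracket_apply, hfst, lie_zero, zero_lie, Prod.mk_zero_zero]

theorem twoCochainSnd_sub_self_mem_twoCoboundary (h : IsInvariantPair R b c)
    (hbc : casimir R s b c = 1) (ha : a ∈ twoCocycle R (s × r) (s × r)) :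
    twoCochainSnd R s r a - a ∈ twoCoboundary R (s × r) (s × r) := by
  obtain ⟨f, hfst, hinl⟩ := exists_sub_d₁₂_fst_and_inl_eq_zero h hbc ha
  have hf : d₁₂ R (s × r) (s × r) f ∈ twoCoboundary R (s × r) (s × r) := ⟨f, rfl⟩
  have fixed := twoCochainSnd_eq_self hfst hinl
  rw [map_sub, sub_eq_sub_iff_sub_eq_sub] at fixed
  rw [fixed]
  exact sub_mem (twoCochainSnd_mem_twoCoboundary hf) hf

variable (R s r)

/-- Restriction along the inclusion `r → s × r`, followed by the projection of the coefficients. -/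
def H2Restriction : H2 R (s × r) (s × r) →ₗ[R] H2 R r r :=
  H2Map (LieHom.inr R s r) (LinearMap.snd R s r) fun _ _ ↦ rfl

/-- Inflation along the projection `s × r → r`, followed by the inclusion of the coefficients. -/
def H2Inflation : H2 R r r →ₗ[R] H2 R (s × r) (s × r) :=
  H2Map (LieHom.snd R s r) (LinearMap.inr R s r) fun x m ↦ by simp

theorem H2Restriction_comp_H2Inflation :
    H2Restriction R s r ∘ₗ H2Inflation R s r = LinearMap.id :=
  Submodule.linearMap_qext _ rfl

variable {R s}

theorem H2Inflation_comp_H2Restriction (h : IsInvariantPair R b c)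
    (hbc : casimir R s b c = 1) :
    H2Inflation R s r ∘ₗ H2Restriction R s r = LinearMap.id := by
  refine Submodule.linearMap_qext _ (LinearMap.ext fun ⟨a, ha⟩ ↦ ?_)
  refine (Submodule.Quotient.eq _).mpr
    (twoCochainSnd_sub_self_mem_twoCoboundary h hbc ha : twoCochainSnd R s r a - a ∈ _)

end Prod

end LieAdjointCohomology

open LieAdjointCohomology in
theorem proposition1_general (K s r : Type*) [Field K]
    [LieRing s] [LieAlgebra K s] [FiniteDimensional K s] [LieAlgebra.IsKilling K s]
    [LieRing r] [LieAlgebra K r] :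
    Nonempty (H2 K (s × r) (s × r) ≃ₗ[K] H2 K r r) := by
  have hκ := LieAlgebra.IsKilling.killingForm_nondegenerate K s
  have hinv : LinearMap.BilinForm.lieInvariant s (killingForm K s) :=
    LieModule.traceForm_lieInvariant K s s
  have hpair := isInvariantPair_dualBasis hκ ⟨LieModule.traceForm_comm K s s⟩ hinv
    (Module.finBasis K s)
  have hcasimir := casimir_dualBasis_killingForm (Module.finBasis K s)
  exact ⟨LinearEquiv.ofLinearMap (H2Restriction K s r) (H2Inflation K s r)
    (H2Restriction_comp_H2Inflation K s r) (H2Inflation_comp_H2Restriction r hpair hcasimir)⟩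

/-- For a finite-dimensional semisimple real Lie algebra `s` and an arbitrary real Lie algebra `r`,
the direct sum `g = s ⊕ r` (the product, with componentwise bracket) satisfies
`H²(g, g) ≅ H²(r, r)` as real vector spaces, with adjoint coefficients on both sides. -/
theorem proposition1 (s r : Type*)
    [LieRing s] [LieAlgebra ℝ s] [FiniteDimensional ℝ s] [LieAlgebra.IsSemisimple ℝ s]
    [LieRing r] [LieAlgebra ℝ r] :
    Nonempty (LieAdjointCohomology.H2 ℝ (s × r) (s × r) ≃ₗ[ℝ] LieAdjointCohomology.H2 ℝ r r) := by
  exact proposition1_general ℝ s r
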